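/- Let $(\Omega,\mathcal F,\mathbb Q)$ be a probability space, $m>0$ and $T>0$. A standard gamma process with growth rate $m$ is a real process $(\gamma_t)_{t\ge 0}$ with independent increments, $\gamma_0=0$ a.s., and, for $t>0$, $\gamma_t$ distributed with density $\mathbf 1_{\{x>0\}}x^{mt-1}e^{-x}/\Gamma(mt)$. A standard gamma bridge over $[0,T]$ with rate $m$ is a process with the same law as $(\gamma_t/\gamma_T)_{0\le t\le T}$ for such a process $\gamma$. Let $X_T$ be a strictly positive integrable random variable with probability density $p$ on $(0,\infty)$, let $(\gamma_{tT})_{0\le t\le T}$ be a standard gamma bridge with rate $m$ that is independent of $X_T$, and set $\xi_t=X_T\gamma_{tT}$ and $\mathcal F_t=\sigma(\xi_s:0\le s\le t)$. Let $P_{tT}$ be a deterministic discount factor and define the reserve $S_t=P_{tT}\,\mathbb E[X_T\mid\mathcal F_t]$. Then, for every $0\le t<T$, almost surely the two integrals below are finite, the denominator is positive, and $$S_t=P_{tT}\,\frac{\int_{\xi_t}^\infty p(x)\,x^{2-mT}(x-\xi_t)^{m(T-t)-1}\,dx}{\int_{\xi_t}^\infty p(x)\,x^{1-mT}(x-\xi_t)^{m(T-t)-1}\,dx}.$$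 Moreover, for every $0\le t<T$, the conditional law of $X_T$ given $\xi_t$, and likewise given $\mathcal F_t$, has the density $$\pi_t(x)=\mathbf 1_{\{x>\xi_t\}}\frac{p(x)\,x^{1-mT}(x-\xi_t)^{m(T-t)-1}}{\int_{\xi_t}^\infty p(z)\,z^{1-mT}(z-\xi_t)^{m(T-t)-1}\,dz},\qquad x>0.$$ -/

import Mathlib

open MeasureTheory ProbabilityTheory Set
open scoped NNReal ENNReal

universe u

/-- A standard gamma process `(γ_t)_{t ≥ 0}` with growth rate `m`: a real process with independent
increments, `γ_0 = 0` almost surely, and, for `t > 0`, `γ_t` gamma distributed with shape `m t`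
and scale `1`. -/
structure IsStandardGammaProcess {Ω : Type u} [MeasurableSpace Ω] (m : ℝ) (γ : ℝ≥0 → Ω → ℝ)
    (Q : Measure Ω) : Prop where
  measurable : ∀ t, Measurable (γ t)
  zero : ∀ᵐ ω ∂Q, γ 0 ω = 0
  indepIncrements : HasIndepIncrements γ Q
  hasLaw : ∀ t : ℝ≥0, 0 < t → HasLaw (γ t) (gammaMeasure (m * t) 1) Q

/-- A standard gamma bridge over `[0, T]` with rate `m`: a real process indexed by `[0, T]` that has
the same law (on the product `σ`-algebra) as `(γ_t / γ_T)_{0 ≤ t ≤ T}` for some standard gamma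
process `γ` with growth rate `m`, possibly living on another probability space.
Here `Set.Iic T` in `ℝ≥0` is the interval `[0, T]`. -/
structure IsStandardGammaBridge {Ω : Type u} [MeasurableSpace Ω] (m : ℝ) (T : ℝ≥0)
    (β : Iic T → Ω → ℝ) (Q : Measure Ω) : Prop where
  measurable : ∀ t, Measurable (β t)
  law : ∃ (Ω' : Type u) (_ : MeasurableSpace Ω') (Q' : Measure Ω') (γ : ℝ≥0 → Ω' → ℝ),
    IsProbabilityMeasure Q' ∧ IsStandardGammaProcess m γ Q' ∧
      IdentDistrib (fun ω (t : Iic T) ↦ β t ω) (fun ω' (t : Iic T) ↦ γ t ω' / γ T ω') Q Q'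

/-- The aggregate claims process `ξ_t = X_T γ_{tT}`. -/
def claimsProcess {Ω : Type u} {T : ℝ≥0} (X : Ω → ℝ) (β : Iic T → Ω → ℝ) (t : Iic T) (ω : Ω) : ℝ :=
  X ω * β t ω

/-- The `σ`-algebra `σ(ξ_s : 0 ≤ s ≤ t)` generated by a process `ξ` up to time `t`. -/
abbrev historySigma {Ω : Type u} {T : ℝ≥0} (ξ : Iic T → Ω → ℝ) (t : Iic T) : MeasurableSpace Ω :=
  ⨆ s : Iic T, ⨆ _ : s ≤ t, MeasurableSpace.comap (ξ s) inferInstance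

/-- The value (reserve) process `S_t = P_{tT} E[X_T | F_t]`, where `F_t` is generated by
`(ξ_s)_{0 ≤ s ≤ t}` and `P s t` is the discount factor from time `t` to time `s`. -/
noncomputable def valueProcess {Ω : Type u} [MeasurableSpace Ω] (Q : Measure Ω) {T : ℝ≥0}
    (P : ℝ≥0 → ℝ≥0 → ℝ) (X : Ω → ℝ) (ξ : Iic T → Ω → ℝ) (t : Iic T) (ω : Ω) : ℝ :=
  P t T * (Q[X | historySigma ξ t]) ω

/-- The function `π_t(x)` of `x`, when `ξ_t = y`. -/
noncomputable def posteriorDensity (m T t : ℝ) (p : ℝ → ℝ) (y x : ℝ) : ℝ :=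
  (Ioi y).indicator
    (fun x ↦ p x * x ^ (1 - m * T) * (x - y) ^ (m * (T - t) - 1) /
      ∫ z in Ioi y, p z * z ^ (1 - m * T) * (z - y) ^ (m * (T - t) - 1)) x

/-!
By the beta-gamma algebra, `γ_s / γ_t` is independent of `γ_t` for `s ≤ t`; together with the
independence of the increments this makes the ratios `(γ_s / γ_t)_{s ≤ t}` independent of
`(γ_t, γ_T)`. Hence `(ξ_s / ξ_t)_{s ≤ t}` is independent of `(ξ_t, X)`, and the history of `ξ` up to
time `t` carries no more information about `X` than `ξ_t` does. Given `X = x`, the variable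
`ξ_t / x` is beta distributed, so the conditional law of `X` is given by Bayes' formula with the
likelihood `x ^ (1 - m T) (x - ξ_t) ^ (m (T - t) - 1)` on `x > ξ_t`. The normalizing constant is
almost surely finite and positive because the conditional law is a probability measure.
-/

lemma measurable_gammaPDF (a r : ℝ) : Measurable (gammaPDF a r) :=
  (measurable_gammaPDFReal a r).ennreal_ofReal

lemma measurable_betaPDF (a b : ℝ) : Measurable (betaPDF a b) :=
  (measurable_betaPDFReal a b).ennreal_ofReal

lemma gammaPDFReal_mul_exp {a r u : ℝ} (hr : 0 < r) (hu : u < r) (x : ℝ) :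
    gammaPDFReal a r x * Real.exp (u * x) =
      (r / (r - u)) ^ a * gammaPDFReal a (r - u) x := by
  have hru : 0 < r - u := sub_pos.2 hu
  unfold gammaPDFReal
  split_ifs
  · have hexp : Real.exp (-((r - u) * x)) = Real.exp (-(r * x)) * Real.exp (u * x) := by
      rw [← Real.exp_add]
      ring_nf
    rw [hexp, Real.div_rpow hr.le hru.le]
    field_simp
  · simp

lemma mgf_id_gammaMeasure {a r u : ℝ} (ha : 0 < a) (hr : 0 < r) (hu : u < r) :
    mgf id (gammaMeasure a r) u = (r / (r - u)) ^ a := by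
  have hru : 0 < r - u := sub_pos.2 hu
  have hone : ∫ x, gammaPDFReal a (r - u) x = 1 := by
    rw [integral_eq_lintegral_of_nonneg_ae
      (ae_of_all _ (gammaPDFReal_nonneg ha hru)) (by fun_prop)]
    exact (congrArg ENNReal.toReal (lintegral_gammaPDF_eq_one ha hru)).trans (by simp)
  calc mgf id (gammaMeasure a r) u
      = ∫ x, gammaPDFReal a r x * Real.exp (u * x) := by
        rw [mgf, gammaMeasure, integral_withDensity_eq_integral_toReal_smul
          (measurable_gammaPDF a r) (ae_of_all _ fun x ↦ ENNReal.ofReal_lt_top)]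
        simp [gammaPDF, ENNReal.toReal_ofReal, gammaPDFReal_nonneg ha hr]
    _ = (r / (r - u)) ^ a := by
        simp_rw [gammaPDFReal_mul_exp hr hu, integral_const_mul, hone, mul_one]

lemma Iio_subset_integrableExpSet_gammaMeasure {a r : ℝ} (ha : 0 < a) (hr : 0 < r) :
    Iio r ⊆ integrableExpSet id (gammaMeasure a r) := by
  intro u hu
  by_contra h
  have hpos : 0 < (r / (r - u)) ^ a := Real.rpow_pos_of_pos (div_pos hr (sub_pos.2 hu)) a
  exact hpos.ne' (mgf_id_gammaMeasure ha hr hu ▸ mgf_undef h)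

lemma analyticOnNhd_div_sub_cpow {r : ℝ} (hr : 0 < r) (c : ℂ) :
    AnalyticOnNhd ℂ (fun z : ℂ ↦ ((r : ℂ) / (r - z)) ^ c) {z | z.re < r} := by
  refine DifferentiableOn.analyticOnNhd (fun z hz ↦ ?_)
    (isOpen_lt Complex.continuous_re continuous_const)
  have hne : (r : ℂ) - z ≠ 0 := fun h ↦ (sub_pos.2 hz).ne' (by simpa using congrArg Complex.re h)
  have hslit : (r : ℂ) / (r - z) ∈ Complex.slitPlane := by
    refine .inl ?_
    rw [Complex.div_re, Complex.ofReal_im, zero_mul, zero_div, add_zero, Complex.ofReal_re,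
      Complex.sub_re, Complex.ofReal_re]
    exact div_pos (mul_pos hr (sub_pos.2 hz)) (Complex.normSq_pos.2 hne)
  exact (((differentiableAt_const _).div (by fun_prop) hne).cpow_const
    hslit).differentiableWithinAt

/- Both sides are analytic in `z` and agree on the real segment. -/
lemma complexMGF_id_gammaMeasure {a r : ℝ} (ha : 0 < a) (hr : 0 < r) {z : ℂ} (hz : z.re < r) :
    complexMGF id (gammaMeasure a r) z = (r / (r - z)) ^ (a : ℂ) := by
  have hanalytic : AnalyticOnNhd ℂ (complexMGF id (gammaMeasure a r)) {w | w.re < r} :=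
    analyticOnNhd_complexMGF.mono fun w hw ↦
      interior_mono (Iio_subset_integrableExpSet_gammaMeasure ha hr) (by simpa using hw)
  refine hanalytic.eqOn_of_preconnected_of_frequently_eq (analyticOnNhd_div_sub_cpow hr a)
    (z₀ := 0) (convex_halfSpace_re_lt r).isPreconnected (by simpa) ?_ hz
  have hreal : Filter.Tendsto ((↑) : ℝ → ℂ) (nhdsWithin 0 {0}ᶜ) (nhdsWithin 0 {0}ᶜ) :=
    tendsto_nhdsWithin_iff.2 ⟨Complex.continuous_ofReal.tendsto' 0 0 rfl |>.mono_left
      nhdsWithin_le_nhds, by filter_upwards [self_mem_nhdsWithin] with u hu; simpa using hu⟩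
  refine hreal.frequently (Filter.Eventually.frequently ?_)
  filter_upwards [nhdsWithin_le_nhds (Iio_mem_nhds hr)] with u hu
  have hnonneg : 0 ≤ r / (r - u) := div_nonneg hr.le (sub_pos.2 hu).le
  rw [complexMGF_ofReal, mgf_id_gammaMeasure ha hr hu, Complex.ofReal_cpow hnonneg]
  push_cast
  rfl

lemma charFun_gammaMeasure {a r : ℝ} (ha : 0 < a) (hr : 0 < r) (u : ℝ) :
    charFun (gammaMeasure a r) u = (r / (r - u * Complex.I)) ^ (a : ℂ) := by
  rw [← complexMGF_id_mul_I, complexMGF_id_gammaMeasure ha hr (by simpa)]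

lemma map_mul_prodMk_withDensity_prod {π : Measure ℝ} [SFinite π] (hπ : ∀ᵐ x ∂π, x ≠ 0)
    {f : ℝ → ℝ≥0∞} (hf : Measurable f) :
    ((volume.withDensity f).prod π).map (fun z ↦ (z.2 * z.1, z.2)) =
      (volume.prod π).withDensity (fun z ↦ ENNReal.ofReal |z.2⁻¹| * f (z.1 / z.2)) := by
  refine Measure.ext_of_lintegral _ fun g hg ↦ ?_
  rw [lintegral_map hg (by fun_prop), lintegral_prod_symm' _ (by fun_prop),
    lintegral_withDensity_eq_lintegral_mul _ (by fun_prop) hg,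
    lintegral_prod_symm' _ (by fun_prop)]
  refine lintegral_congr_ae ?_
  filter_upwards [hπ] with x hx
  calc ∫⁻ c, g (x * c, x) ∂volume.withDensity f
      = ∫⁻ c, f (x * c / x) * g (x * c, x) := by
        rw [lintegral_withDensity_eq_lintegral_mul _ hf (by fun_prop)]
        simp [mul_div_cancel_left₀ _ hx]
    _ = ∫⁻ y, f (y / x) * g (y, x) ∂volume.map (x * ·) :=
        (lintegral_map (f := fun y ↦ f (y / x) * g (y, x)) (by fun_prop) (by fun_prop)).symm
    _ = ∫⁻ y, ENNReal.ofReal |x⁻¹| * f (y / x) * g (y, x) := by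
        rw [Real.map_volume_mul_left hx, lintegral_smul_measure, smul_eq_mul,
          ← lintegral_const_mul _ (by fun_prop)]
        simp_rw [mul_assoc]

lemma map_prodMk_add_withDensity_prod_withDensity {f g : ℝ → ℝ≥0∞} (hf : Measurable f)
    (hg : Measurable g) :
    ((volume.withDensity f).prod (volume.withDensity g)).map (fun z ↦ (z.1, z.1 + z.2)) =
      (volume.prod volume).withDensity (fun z ↦ f z.1 * g (z.2 - z.1)) := by
  refine Measure.ext_of_lintegral _ fun h hh ↦ ?_
  have hdensity : Measurable fun z : ℝ × ℝ ↦ f z.1 * g (z.2 - z.1) := by fun_prop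
  rw [prod_withDensity hf hg, lintegral_map hh (by fun_prop),
    lintegral_withDensity_eq_lintegral_mul _ (by fun_prop) (by fun_prop),
    lintegral_withDensity_eq_lintegral_mul _ hdensity hh,
    ← (measurePreserving_prod_add volume volume).lintegral_comp (hdensity.mul hh)]
  simp

lemma gammaPDF_mul_ofReal_abs_inv_mul_betaPDF {a b r x y : ℝ} (ha : 0 < a) (hb : 0 < b)
    (hr : 0 < r) (hx : x ≠ 0) (hy : y ≠ 0) (hyx : y ≠ x) :
    gammaPDF (a + b) r x * (ENNReal.ofReal |x⁻¹| * betaPDF a b (y / x)) =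
      gammaPDF a r y * gammaPDF b r (x - y) := by
  rcases hy.lt_or_gt with hy | hy
  · rcases hx.lt_or_gt with hx | hx
    · simp [gammaPDF_of_neg hy, gammaPDF_of_neg hx]
    · simp [gammaPDF_of_neg hy, betaPDF_eq_zero_of_nonpos (div_neg_of_neg_of_pos hy hx).le]
  rcases hyx.lt_or_gt with hyx | hyx
  swap
  · rcases hx.lt_or_gt with hx | hx
    · simp [gammaPDF_of_neg (sub_neg.2 hyx), gammaPDF_of_neg hx]
    · simp [gammaPDF_of_neg (sub_neg.2 hyx), betaPDF_eq_zero_of_one_le ((one_le_div hx).2 hyx.le)]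
  have hx : 0 < x := hy.trans hyx
  have hxy : 0 < x - y := sub_pos.2 hyx
  rw [betaPDF_of_pos_lt_one (div_pos hy hx) ((div_lt_one hx).2 hyx), gammaPDF_of_nonneg hx.le,
    gammaPDF_of_nonneg hy.le, gammaPDF_of_nonneg hxy.le, abs_of_pos (inv_pos.2 hx),
    ← ENNReal.ofReal_mul (by positivity), ← ENNReal.ofReal_mul (by positivity),
    ← ENNReal.ofReal_mul (by positivity)]
  congr 1
  have hexp : Real.exp (-(r * x)) = Real.exp (-(r * y)) * Real.exp (-(r * (x - y))) := by
    rw [← Real.exp_add]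
    ring_nf
  have hpow : x ^ (a + b - 1) = x * x ^ (a - 1) * x ^ (b - 1) := by
    rw [show a + b - 1 = 1 + (a - 1) + (b - 1) by ring, Real.rpow_add hx, Real.rpow_add hx,
      Real.rpow_one]
  rw [one_sub_div hx.ne', Real.div_rpow hy.le hx.le, Real.div_rpow hxy.le hx.le, hexp, hpow,
    Real.rpow_add hr, beta]
  field_simp

lemma ae_pos_gammaMeasure (a r : ℝ) : ∀ᵐ x ∂gammaMeasure a r, 0 < x := by
  refine (ae_withDensity_iff (measurable_gammaPDF a r)).2 ?_
  filter_upwards [Measure.ae_ne volume 0] with x hx h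
  exact hx.symm.lt_of_le (not_lt.1 (mt gammaPDF_of_neg h))

lemma ae_pos_betaMeasure (a b : ℝ) : ∀ᵐ x ∂betaMeasure a b, 0 < x :=
  (ae_withDensity_iff (measurable_betaPDF a b)).2 <| ae_of_all _ fun _ h ↦
    not_le.1 (mt betaPDF_eq_zero_of_nonpos h)

lemma map_mul_prodMk_betaMeasure_prod_gammaMeasure {a b r : ℝ} (ha : 0 < a) (hb : 0 < b)
    (hr : 0 < r) :
    ((betaMeasure a b).prod (gammaMeasure (a + b) r)).map (fun z ↦ (z.2 * z.1, z.2)) =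
      ((gammaMeasure a r).prod (gammaMeasure b r)).map (fun z ↦ (z.1, z.1 + z.2)) := by
  have mg (a : ℝ) := measurable_gammaPDF a r
  have mb := measurable_betaPDF a b
  have hne : ∀ᵐ z ∂(volume : Measure ℝ).prod volume, z.2 ≠ 0 ∧ z.1 ≠ 0 ∧ z.1 ≠ z.2 := by
    filter_upwards [Measure.quasiMeasurePreserving_snd.ae (Measure.ae_ne volume (0 : ℝ)),
      Measure.quasiMeasurePreserving_fst.ae (Measure.ae_ne volume (0 : ℝ)),
      (quasiMeasurePreserving_sub volume volume).ae (Measure.ae_ne volume (0 : ℝ))]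
      with z h2 h1 h12 using ⟨h2, h1, sub_ne_zero.1 h12⟩
  have hpos := (ae_pos_gammaMeasure (a + b) r).mono fun _ ↦ ne_of_gt
  unfold gammaMeasure at *
  rw [map_prodMk_add_withDensity_prod_withDensity (mg a) (mg b), betaMeasure,
    map_mul_prodMk_withDensity_prod hpos mb, prod_withDensity_right (mg _),
    ← withDensity_mul _ (by fun_prop) (by fun_prop)]
  refine withDensity_congr_ae ?_
  filter_upwards [hne] with z ⟨h2, h1, h12⟩
  exact gammaPDF_mul_ofReal_abs_inv_mul_betaPDF ha hb hr h2 h1 h12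

lemma map_div_add_prodMk_add_gammaMeasure_prod_gammaMeasure {a b r : ℝ} (ha : 0 < a) (hb : 0 < b)
    (hr : 0 < r) :
    ((gammaMeasure a r).prod (gammaMeasure b r)).map (fun z ↦ (z.1 / (z.1 + z.2), z.1 + z.2)) =
      (betaMeasure a b).prod (gammaMeasure (a + b) r) := by
  calc ((gammaMeasure a r).prod (gammaMeasure b r)).map (fun z ↦ (z.1 / (z.1 + z.2), z.1 + z.2))
      = (((betaMeasure a b).prod (gammaMeasure (a + b) r)).map (fun z ↦ (z.2 * z.1, z.2))).map
          (fun z ↦ (z.1 / z.2, z.2)) := by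
        rw [map_mul_prodMk_betaMeasure_prod_gammaMeasure ha hb hr,
          Measure.map_map (by fun_prop) (by fun_prop)]
        rfl
    _ = ((betaMeasure a b).prod (gammaMeasure (a + b) r)).map id := by
        rw [Measure.map_map (by fun_prop) (by fun_prop)]
        refine Measure.map_congr ?_
        filter_upwards [Measure.quasiMeasurePreserving_snd.ae (ae_pos_gammaMeasure (a + b) r)]
          with z hz
        simp [mul_div_cancel_left₀ _ hz.ne']
    _ = (betaMeasure a b).prod (gammaMeasure (a + b) r) := Measure.map_id

/-- The likelihood of the parameter `x` given the observation `y` of `x * B`, where `B` has the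
beta distribution with parameters `c - b` and `b`: the density of `x * B` at `y`, without the
factors that do not depend on `x`. -/
noncomputable def scaledBetaLikelihood (c b y x : ℝ) : ℝ :=
  (Ioi y).indicator (fun x ↦ x ^ (1 - c) * (x - y) ^ (b - 1)) x

lemma scaledBetaLikelihood_of_lt {c b x y : ℝ} (h : y < x) :
    scaledBetaLikelihood c b y x = x ^ (1 - c) * (x - y) ^ (b - 1) :=
  indicator_of_mem (mem_Ioi.2 h) _

lemma scaledBetaLikelihood_of_le {c b x y : ℝ} (h : x ≤ y) : scaledBetaLikelihood c b y x = 0 :=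
  indicator_of_notMem (notMem_Ioi.2 h) _

lemma scaledBetaLikelihood_zero_self {c x : ℝ} (hx : 0 < x) :
    scaledBetaLikelihood c c 0 x = 1 := by
  rw [scaledBetaLikelihood_of_lt hx, sub_zero, ← Real.rpow_add hx, sub_add_sub_cancel, sub_self,
    Real.rpow_zero]

lemma measurable_scaledBetaLikelihood (c b : ℝ) :
    Measurable fun z : ℝ × ℝ ↦ scaledBetaLikelihood c b z.1 z.2 := by
  have hset : MeasurableSet {z : ℝ × ℝ | z.1 < z.2} :=
    measurableSet_lt measurable_fst measurable_snd
  exact Measurable.indicator (s := {z : ℝ × ℝ | z.1 < z.2})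
    (f := fun z ↦ z.2 ^ (1 - c) * (z.2 - z.1) ^ (b - 1)) (by fun_prop) hset

lemma ofReal_inv_mul_betaPDF_div {a b x y : ℝ} (hx : 0 < x) :
    ENNReal.ofReal x⁻¹ * betaPDF a b (y / x) =
      (Ioi 0).indicator (fun y ↦ ENNReal.ofReal (1 / beta a b * y ^ (a - 1))) y *
        ENNReal.ofReal (scaledBetaLikelihood (a + b) b y x) := by
  rcases le_or_gt y 0 with hy | hy
  · rw [betaPDF_eq_zero_of_nonpos (div_nonpos_of_nonpos_of_nonneg hy hx.le),
      indicator_of_notMem (notMem_Ioi.2 hy), mul_zero, zero_mul]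
  rcases le_or_gt x y with hxy | hyx
  · rw [betaPDF_eq_zero_of_one_le ((one_le_div hx).2 hxy), scaledBetaLikelihood_of_le hxy,
      ENNReal.ofReal_zero, mul_zero, mul_zero]
  have hsub : 0 < x - y := sub_pos.2 hyx
  rw [betaPDF_of_pos_lt_one (div_pos hy hx) ((div_lt_one hx).2 hyx),
    indicator_of_mem (mem_Ioi.2 hy), scaledBetaLikelihood_of_lt hyx,
    ← ENNReal.ofReal_mul (by positivity), ← ENNReal.ofReal_mul' (by positivity)]
  congr 1
  have hpow : x ^ (1 - (a + b)) = x⁻¹ / (x ^ (a - 1) * x ^ (b - 1)) := by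
    rw [← Real.rpow_add hx, ← Real.rpow_neg_one, ← Real.rpow_sub hx]
    ring_nf
  rw [one_sub_div hx.ne', Real.div_rpow hy.le hx.le, Real.div_rpow hsub.le hx.le, hpow]
  field_simp

lemma map_mul_prodMk_betaMeasure_prod (a b : ℝ) {π : Measure ℝ} [SFinite π]
    (hπ : ∀ᵐ x ∂π, 0 < x) :
    ((betaMeasure a b).prod π).map (fun z ↦ (z.2 * z.1, z.2)) =
      ((volume.withDensity
        ((Ioi 0).indicator fun y ↦ ENNReal.ofReal (1 / beta a b * y ^ (a - 1)))).prod π).withDensity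
        (fun z ↦ ENNReal.ofReal (scaledBetaLikelihood (a + b) b z.1 z.2)) := by
  have hfactor : Measurable
      ((Ioi 0).indicator fun y : ℝ ↦ ENNReal.ofReal (1 / beta a b * y ^ (a - 1))) :=
    Measurable.indicator (by fun_prop) measurableSet_Ioi
  rw [betaMeasure, map_mul_prodMk_withDensity_prod (hπ.mono fun _ ↦ ne_of_gt)
    (measurable_betaPDF a b), prod_withDensity_left hfactor, ← withDensity_mul _
    (by exact hfactor.comp measurable_fst) (measurable_scaledBetaLikelihood _ b).ennreal_ofReal]
  refine withDensity_congr_ae ?_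
  filter_upwards [Measure.quasiMeasurePreserving_snd.ae hπ] with z hz
  rw [abs_of_pos (inv_pos.2 hz), ofReal_inv_mul_betaPDF_div hz]
  rfl

lemma map_mul_prodMk_dirac_prod (c : ℝ) {π : Measure ℝ} [SFinite π] (hπ : ∀ᵐ x ∂π, 0 < x) :
    ((Measure.dirac 0).prod π).map (fun z : ℝ × ℝ ↦ (z.2 * z.1, z.2)) =
      ((Measure.dirac 0).prod π).withDensity
        (fun z ↦ ENNReal.ofReal (scaledBetaLikelihood c c z.1 z.2)) := by
  have hone : (fun z : ℝ × ℝ ↦ ENNReal.ofReal (scaledBetaLikelihood c c z.1 z.2))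
      =ᵐ[(Measure.dirac (0 : ℝ)).prod π] fun _ ↦ 1 := by
    rw [Measure.dirac_prod]
    refine (ae_map_iff (by fun_prop) (measurableSet_eq_fun
      (measurable_scaledBetaLikelihood c c).ennreal_ofReal measurable_const)).2 ?_
    filter_upwards [hπ] with x hx
    rw [scaledBetaLikelihood_zero_self hx, ENNReal.ofReal_one]
  rw [withDensity_congr_ae hone, withDensity_const, one_smul, Measure.dirac_prod,
    Measure.map_map (by fun_prop) (by fun_prop)]
  simp only [Function.comp_def, mul_zero]

section Independence

variable {Ω α β δ : Type*} [MeasurableSpace Ω] [MeasurableSpace α] [MeasurableSpace β]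
  [MeasurableSpace δ] {μ : Measure Ω} [IsProbabilityMeasure μ] {A : Ω → α} {B : Ω → β} {C : Ω → δ}

lemma indepFun_prodMk_left_of_indepFun_prodMk_right (hA : Measurable A) (hB : Measurable B)
    (hC : Measurable C) (hABC : IndepFun A (fun ω ↦ (B ω, C ω)) μ) (hBC : IndepFun B C μ) :
    IndepFun (fun ω ↦ (A ω, B ω)) C μ := by
  have hAB : IndepFun A B μ := hABC.comp measurable_id measurable_fst
  rw [indepFun_iff_map_prod_eq_prod_map_map (by fun_prop) (by fun_prop)] at *
  refine MeasurableEquiv.prodAssoc.map_measurableEquiv_injective ?_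
  rw [hAB, Measure.prodAssoc_prod, ← hBC, ← hABC, Measure.map_map (by fun_prop) (by fun_prop)]
  rfl

lemma indepFun_prodMk_right_of_indepFun_prodMk_left (hA : Measurable A) (hB : Measurable B)
    (hC : Measurable C) (hABC : IndepFun (fun ω ↦ (A ω, B ω)) C μ) (hAB : IndepFun A B μ) :
    IndepFun A (fun ω ↦ (B ω, C ω)) μ :=
  (indepFun_prodMk_left_of_indepFun_prodMk_right hC hB hA
    (hABC.symm.comp measurable_id measurable_swap) hAB.symm).symm.comp measurable_id measurable_swap

end Independence

section IndependentIncrements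

variable {ι : Type*} [LinearOrder ι] [OrderBot ι]

lemma exists_monotone_nat_of_forall_le (K : Finset ι) {s t : ι} (hK : ∀ i ∈ K, i ≤ s)
    (hst : s ≤ t) :
    ∃ (τ : ℕ → ι) (n : ℕ), Monotone τ ∧ τ 0 = ⊥ ∧ τ n = s ∧ τ (n + 1) = t ∧
      ∀ i ∈ K, ∃ k ≤ n, τ k = i := by
  induction K using Finset.induction_on_max generalizing s t with
  | empty =>
    refine ⟨fun | 0 => ⊥ | 1 => s | _ => t, 1, monotone_nat_of_le_succ ?_, rfl, rfl, rfl, by simp⟩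
    rintro (_ | _ | k)
    exacts [bot_le, hst, le_rfl]
  | insert a K hlt ih =>
    obtain ⟨τ, n, hτ, hbot, ha, hs, hrange⟩ :=
      ih (fun i hi ↦ (hlt i hi).le) (hK a (Finset.mem_insert_self a K))
    refine ⟨fun k ↦ if k ≤ n + 1 then τ k else t, n + 1, monotone_nat_of_le_succ fun k ↦ ?_,
      by simpa, by simpa, by simp, ?_⟩
    · rcases lt_trichotomy k (n + 1) with hk | rfl | hk
      · simpa [hk.le, Nat.succ_le_of_lt hk] using hτ k.le_succ
      · simpa [hs] using hst
      · simp [hk.not_ge, (hk.trans k.lt_succ_self).not_ge]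
    · refine (Finset.forall_mem_insert _ _ _).2 ⟨⟨n, n.le_succ, by simpa⟩, fun i hi ↦ ?_⟩
      obtain ⟨k, hk, rfl⟩ := hrange i hi
      exact ⟨k, hk.trans n.le_succ, by simp [hk.trans n.le_succ]⟩

variable {Ω E : Type*} [MeasurableSpace Ω] {P : Measure Ω} [IsProbabilityMeasure P]
  [AddCommGroup E] [MeasurableSpace E] [MeasurableAdd₂ E] [MeasurableSub₂ E] {X : ι → Ω → E}

lemma indepFun_process_sub (hX : HasIndepIncrements X P) (hmeas : ∀ t, Measurable (X t))
    (hbot : ∀ᵐ ω ∂P, X ⊥ ω = 0) {s t : ι} (hst : s ≤ t) :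
    IndepFun (fun ω (r : Iic s) ↦ X r ω) (fun ω ↦ X t ω - X s ω) P := by
  refine IndepFun.process_indepFun (fun r ↦ hmeas r) (by fun_prop) fun I ↦ ?_
  obtain ⟨τ, n, hτ, hτ0, hτn, hτn', hI⟩ := exists_monotone_nat_of_forall_le
    (I.image Subtype.val) (by simp +contextual) hst
  choose κ hκn hκ using fun i : I ↦ hI i (Finset.mem_image_of_mem _ i.2)
  have hdisj := (hX.nat hτ).indepFun_finset (Finset.range n) {n} (by simp) (fun i ↦ by fun_prop)
  have hlast : Measurable fun d : ({n} : Finset ℕ) → E ↦ d ⟨n, Finset.mem_singleton_self n⟩ :=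
    measurable_pi_apply _
  have hsum := hdisj.comp
    (φ := fun d i ↦ ∑ j : Finset.range n with j.1 < κ i, d j)
    (by fun_prop) hlast
  refine hsum.congr ?_ (ae_of_all _ fun ω ↦ by simp [hτn, hτn'])
  filter_upwards [hbot] with ω hω
  funext i
  calc ∑ j : Finset.range n with j.1 < κ i, (X (τ (j + 1)) ω - X (τ j) ω)
      = ∑ j ∈ Finset.range n with j < κ i, (X (τ (j + 1)) ω - X (τ j) ω) := by
        rw [Finset.sum_filter, Finset.sum_filter, Finset.univ_eq_attach]
        exact Finset.sum_attach _ fun j ↦ if j < κ i then X (τ (j + 1)) ω - X (τ j) ω else 0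
    _ = ∑ j ∈ Finset.range (κ i), (X (τ (j + 1)) ω - X (τ j) ω) := by
        congr 1
        grind
    _ = X i ω := by
        rw [Finset.sum_range_sub fun j ↦ X (τ j) ω, hκ, hτ0, hω, sub_zero]

end IndependentIncrements

namespace IsStandardGammaProcess

variable {Ω : Type u} [MeasurableSpace Ω] {Q : Measure Ω} {m : ℝ}
  {γ : ℝ≥0 → Ω → ℝ}

lemma ae_pos (hγ : IsStandardGammaProcess m γ Q) {t : ℝ≥0} (ht : 0 < t) : ∀ᵐ ω ∂Q, 0 < γ t ω :=
  ae_of_ae_map (hγ.measurable t).aemeasurable <| by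
    rw [(hγ.hasLaw t ht).map_eq]
    exact ae_pos_gammaMeasure _ _

lemma indepFun_sub (hγ : IsStandardGammaProcess m γ Q) {s t : ℝ≥0} (hst : s ≤ t) :
    IndepFun (γ s) (γ t - γ s) Q :=
  hγ.indepIncrements.indepFun_eval_sub bot_le hst hγ.zero

variable [IsProbabilityMeasure Q]

lemma map_sub (hγ : IsStandardGammaProcess m γ Q) (hm : 0 < m) {s t : ℝ≥0} (hst : s < t) :
    Q.map (γ t - γ s) = gammaMeasure (m * (t - s)) 1 := by
  have ht : 0 < t := bot_le.trans_lt hst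
  have hmst : 0 < m * ((t : ℝ) - s) := mul_pos hm (sub_pos.2 hst)
  rcases eq_zero_or_pos s with rfl | hs
  · rw [NNReal.coe_zero, sub_zero, ← (hγ.hasLaw t ht).map_eq]
    exact Measure.map_congr (by filter_upwards [hγ.zero] with ω hω; simp [hω])
  have hms : 0 < m * (s : ℝ) := mul_pos hm hs
  have hmt : 0 < m * (t : ℝ) := mul_pos hm ht
  have := isProbabilityMeasure_gammaMeasure hmst one_pos
  have hγs := hγ.measurable s
  have hγt := hγ.measurable t
  refine Measure.ext_of_charFun (funext fun u ↦ ?_)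
  have hbase : ((1 : ℝ) : ℂ) / ((1 : ℝ) - u * Complex.I) ≠ 0 :=
    div_ne_zero (by simp) fun h ↦ by simpa using congrArg Complex.re h
  have hmul := congrFun ((hγ.indepFun_sub hst.le).charFun_map_add_eq_mul hγs.aemeasurable
    (hγt.sub hγs).aemeasurable) u
  rw [Pi.mul_apply, add_sub_cancel, (hγ.hasLaw t ht).map_eq, (hγ.hasLaw s hs).map_eq,
    charFun_gammaMeasure hmt one_pos, charFun_gammaMeasure hms one_pos,
    show m * (t : ℝ) = m * s + m * (t - s) by ring, Complex.ofReal_add,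
    Complex.cpow_add _ _ hbase, ← charFun_gammaMeasure hmst one_pos] at hmul
  exact (mul_left_cancel₀ (Complex.cpow_ne_zero_iff.2 (.inl hbase)) hmul).symm

lemma map_div_prodMk (hγ : IsStandardGammaProcess m γ Q) (hm : 0 < m) {s t : ℝ≥0} (hs : 0 < s)
    (hst : s < t) :
    Q.map (fun ω ↦ (γ s ω / γ t ω, γ t ω)) =
      (betaMeasure (m * s) (m * (t - s))).prod (gammaMeasure (m * t) 1) := by
  have hγs := hγ.measurable s
  have hγt := hγ.measurable t
  have hms : 0 < m * (s : ℝ) := mul_pos hm hs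
  have hmst : 0 < m * ((t : ℝ) - s) := mul_pos hm (sub_pos.2 hst)
  have hlaw := (hγ.indepFun_sub hst.le).map_prod_eq_prod_map_map hγs.aemeasurable
    (hγt.sub hγs).aemeasurable
  rw [hγ.map_sub hm hst, (hγ.hasLaw s hs).map_eq] at hlaw
  rw [show m * (t : ℝ) = m * s + m * (t - s) by ring,
    ← map_div_add_prodMk_add_gammaMeasure_prod_gammaMeasure hms hmst one_pos, ← hlaw,
    Measure.map_map (by fun_prop) (by fun_prop)]
  congr with ω <;> simp

lemma map_div (hγ : IsStandardGammaProcess m γ Q) (hm : 0 < m) {s t : ℝ≥0} (hs : 0 < s)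
    (hst : s < t) :
    Q.map (fun ω ↦ γ s ω / γ t ω) = betaMeasure (m * s) (m * (t - s)) := by
  have := isProbabilityMeasure_gammaMeasure
    (mul_pos hm (NNReal.coe_pos.2 (hs.trans hst))) one_pos
  rw [← Measure.fst_map_prodMk (hγ.measurable t), hγ.map_div_prodMk hm hs hst, Measure.fst_prod]

lemma indepFun_div (hγ : IsStandardGammaProcess m γ Q) (hm : 0 < m) {s t : ℝ≥0} (hst : s ≤ t) :
    IndepFun (fun ω ↦ γ s ω / γ t ω) (γ t) Q := by
  have hγs := hγ.measurable s
  have hγt := hγ.measurable t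
  rcases eq_zero_or_pos s with rfl | hs
  · refine (indepFun_const_left (0 : ℝ) (γ t)).congr ?_ .rfl
    filter_upwards [hγ.zero] with ω hω
    simp [hω]
  rcases hst.eq_or_lt with rfl | hst
  · refine (indepFun_const_left (1 : ℝ) (γ s)).congr ?_ .rfl
    filter_upwards [hγ.ae_pos hs] with ω hω
    exact (div_self hω.ne').symm
  rw [indepFun_iff_map_prod_eq_prod_map_map (by fun_prop) (by fun_prop),
    hγ.map_div_prodMk hm hs hst, hγ.map_div hm hs hst, (hγ.hasLaw t (hs.trans hst)).map_eq]

lemma indepFun_div_finset (hγ : IsStandardGammaProcess m γ Q) (hm : 0 < m) (K : Finset ℝ≥0)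
    {t : ℝ≥0} (hK : ∀ s ∈ K, s ≤ t) :
    IndepFun (fun ω (s : K) ↦ γ s ω / γ t ω) (γ t) Q := by
  have hmeas := hγ.measurable
  induction K using Finset.induction_on_max generalizing t with
  | empty =>
    exact (indepFun_const_left (0 : (∅ : Finset ℝ≥0) → ℝ) (γ t)).congr
      (ae_of_all _ fun ω ↦ Subsingleton.elim _ _) .rfl
  | insert a K hlt ih =>
    have hat : a ≤ t := hK a (Finset.mem_insert_self a K)
    have hsub : IndepFun (fun ω ↦ ((fun s : K ↦ γ s ω / γ a ω), γ a ω))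
        (fun ω ↦ γ t ω - γ a ω) Q :=
      (indepFun_process_sub hγ.indepIncrements hmeas hγ.zero hat).comp
        (φ := fun x : Iic a → ℝ ↦
          ((fun s : K ↦ x ⟨s, (hlt s s.2).le⟩ / x ⟨a, self_mem_Iic⟩), x ⟨a, self_mem_Iic⟩))
        (by fun_prop) measurable_id
    have hratio : IndepFun (fun ω (s : K) ↦ γ s ω / γ a ω)
        (fun ω ↦ (γ a ω / γ t ω, γ t ω)) Q := by
      simpa [Function.comp_def] using (indepFun_prodMk_right_of_indepFun_prodMk_left (by fun_prop)
        (hmeas a) (by fun_prop) hsub (ih fun s hs ↦ (hlt s hs).le)).comp measurable_id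
        (ψ := fun z : ℝ × ℝ ↦ (z.1 / (z.1 + z.2), z.1 + z.2)) (by fun_prop)
    have hglue : Measurable fun (z : (K → ℝ) × ℝ) (s : ↥(insert a K)) ↦
        if h : s.1 ∈ K then z.1 ⟨s, h⟩ * z.2 else z.2 :=
      measurable_pi_lambda _ fun s ↦ by split_ifs <;> fun_prop
    refine ((indepFun_prodMk_left_of_indepFun_prodMk_right (by fun_prop) (by fun_prop)
      (hmeas t) hratio (hγ.indepFun_div hm hat)).comp hglue measurable_id).congr ?_ .rfl
    filter_upwards [Filter.eventually_imp_distrib_left.2 hγ.ae_pos] with ω hω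
    ext s
    by_cases h : s.1 ∈ K
    · have := (hω (bot_le.trans_lt (hlt s h))).ne'
      simp only [Function.comp_apply, dif_pos h]
      field_simp
    · have : s.1 = a := (Finset.mem_insert.1 s.2).resolve_right h
      simp only [Function.comp_apply, dif_neg h]
      rw [this]

lemma indepFun_div_process (hγ : IsStandardGammaProcess m γ Q) (hm : 0 < m) (t : ℝ≥0) :
    IndepFun (fun ω (s : Iic t) ↦ γ s ω / γ t ω) (γ t) Q := by
  have hmeas := hγ.measurable
  refine IndepFun.process_indepFun (fun s ↦ by fun_prop) (hmeas t) fun I ↦ ?_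
  exact (hγ.indepFun_div_finset hm (I.image Subtype.val) (t := t) (by simp +contextual)).comp
    (φ := fun x (s : I) ↦ x ⟨s, Finset.mem_image_of_mem _ s.2⟩) (by fun_prop) measurable_id

lemma indepFun_div_process_prodMk (hγ : IsStandardGammaProcess m γ Q) (hm : 0 < m) {t u : ℝ≥0}
    (htu : t ≤ u) :
    IndepFun (fun ω (s : Iic t) ↦ γ s ω / γ t ω) (fun ω ↦ (γ t ω, γ u ω - γ t ω)) Q := by
  have hmeas := hγ.measurable
  refine indepFun_prodMk_right_of_indepFun_prodMk_left (by fun_prop) (hmeas t) (by fun_prop) ?_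
    (hγ.indepFun_div_process hm t)
  exact (indepFun_process_sub hγ.indepIncrements hmeas hγ.zero htu).comp
    (φ := fun x : Iic t → ℝ ↦ ((fun s ↦ x s / x ⟨t, self_mem_Iic⟩), x ⟨t, self_mem_Iic⟩))
    (by fun_prop) measurable_id

end IsStandardGammaProcess

namespace IsStandardGammaBridge

variable {Ω : Type u} [MeasurableSpace Ω] {Q : Measure Ω} {m : ℝ} {T : ℝ≥0} {β : Iic T → Ω → ℝ}
  {t : Iic T}

lemma ae_eq_zero (hβ : IsStandardGammaBridge m T β Q) (ht : (t : ℝ≥0) = 0) :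
    ∀ᵐ ω ∂Q, β t ω = 0 := by
  obtain ⟨Ω', _, Q', γ, _, hγ, hid⟩ := hβ.law
  refine (hid.comp (u := fun x ↦ x t) (by fun_prop)).symm.ae_snd (p := fun x ↦ x = 0)
    (measurableSet_singleton 0) ?_
  filter_upwards [hγ.zero] with ω hω
  simp [ht, hω]

lemma map_eq_betaMeasure (hβ : IsStandardGammaBridge m T β Q) (hm : 0 < m) (ht0 : 0 < (t : ℝ≥0))
    (htT : (t : ℝ≥0) < T) : Q.map (β t) = betaMeasure (m * t) (m * (T - t)) := by
  obtain ⟨Ω', _, Q', γ, _, hγ, hid⟩ := hβ.law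
  exact (hid.comp (measurable_pi_apply t)).map_eq.trans (hγ.map_div hm ht0 htT)

lemma ae_pos (hβ : IsStandardGammaBridge m T β Q) (hm : 0 < m) (ht0 : 0 < (t : ℝ≥0))
    (htT : (t : ℝ≥0) < T) : ∀ᵐ ω ∂Q, 0 < β t ω :=
  ae_of_ae_map (hβ.measurable t).aemeasurable <| by
    rw [hβ.map_eq_betaMeasure hm ht0 htT]
    exact ae_pos_betaMeasure _ _

lemma ae_nonneg (hβ : IsStandardGammaBridge m T β Q) (hm : 0 < m) (htT : (t : ℝ≥0) < T) :
    ∀ᵐ ω ∂Q, 0 ≤ β t ω := by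
  rcases eq_zero_or_pos (t : ℝ≥0) with ht0 | ht0
  · exact (hβ.ae_eq_zero ht0).mono fun ω hω ↦ hω.ge
  · exact (hβ.ae_pos hm ht0 htT).mono fun ω hω ↦ hω.le

lemma ae_mul_div_eq (hβ : IsStandardGammaBridge m T β Q) (hm : 0 < m) (htT : (t : ℝ≥0) < T) :
    ∀ᵐ ω ∂Q, ∀ s : Iic t, β t ω * (β s ω / β t ω) = β s ω := by
  rcases eq_zero_or_pos (t : ℝ≥0) with ht0 | ht0
  · refine ae_of_all _ fun ω s ↦ ?_
    have hs : (s : Iic T) = t := le_antisymm s.2 (ht0.trans_le zero_le)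
    rw [hs, ← mul_div_assoc, mul_self_div_self]
  · filter_upwards [hβ.ae_pos hm ht0 htT] with ω hω s
    exact mul_div_cancel₀ _ hω.ne'

variable [IsProbabilityMeasure Q]

lemma map_eq_dirac (hβ : IsStandardGammaBridge m T β Q) (ht : (t : ℝ≥0) = 0) :
    Q.map (β t) = Measure.dirac 0 :=
  (hasLaw_dirac_of_ae_eq (hβ.ae_eq_zero ht)).map_eq

lemma indepFun_div_process (hβ : IsStandardGammaBridge m T β Q) (hm : 0 < m) (hT : 0 < T)
    (t : Iic T) : IndepFun (fun ω (s : Iic t) ↦ β s ω / β t ω) (β t) Q := by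
  obtain ⟨Ω', _, Q', γ, _, hγ, hid⟩ := hβ.law
  have hratio : IndepFun (fun ω (s : Iic t) ↦ γ s ω / γ t ω) (fun ω ↦ γ t ω / γ T ω) Q' := by
    simpa [Function.comp_def] using (hγ.indepFun_div_process_prodMk hm t.2).comp
      (φ := fun (x : Iic (t : ℝ≥0) → ℝ) (s : Iic t) ↦ x ⟨s, s.2⟩)
      (ψ := fun z : ℝ × ℝ ↦ z.1 / (z.1 + z.2)) (by fun_prop) (by fun_prop)
  have hpair := (hid.comp (u := fun x ↦ ((fun s : Iic t ↦ x s / x t), x t)) (by fun_prop)).symm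
  refine indepFun_of_identDistrib_pair (hratio.congr ?_ .rfl) hpair
  filter_upwards [hγ.ae_pos hT] with ω hω
  exact funext fun s ↦ (div_div_div_cancel_right₀ hω.ne' _ _).symm

end IsStandardGammaBridge

section Bayes

variable {α E : Type*} [MeasurableSpace α] [MeasurableSpace E] {μ : Measure α} [SFinite μ]
  {ν : Measure E} [SFinite ν] {f : α × E → ℝ≥0∞}

lemma fst_withDensity_prod (hf : Measurable f) :
    ((μ.prod ν).withDensity f).fst = μ.withDensity fun y ↦ ∫⁻ x, f (y, x) ∂ν := by
  ext s hs
  rw [Measure.fst_apply hs, withDensity_apply _ (measurable_fst hs), withDensity_apply _ hs,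
    ← prod_univ, setLIntegral_prod _ hf.aemeasurable.restrict]
  simp

/-- The posterior law of a parameter with prior `ν`, given an observation `y` whose likelihood is
`f (y, ·)`. The likelihood need not be normalized. -/
noncomputable def bayesKernel (ν : Measure E) [SFinite ν] (f : α × E → ℝ≥0∞) : Kernel α E :=
  (Kernel.const α ν).withDensity fun y x ↦ (∫⁻ x', f (y, x') ∂ν)⁻¹ * f (y, x)

lemma measurable_inv_lintegral_mul (hf : Measurable f) :
    Measurable fun z : α × E ↦ (∫⁻ x, f (z.1, x) ∂ν)⁻¹ * f z := by
  fun_prop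

lemma bayesKernel_apply (hf : Measurable f) (y : α) :
    bayesKernel ν f y = (ν.withDensity (fun x ↦ f (y, x)) univ)⁻¹ •
      ν.withDensity fun x ↦ f (y, x) := by
  rw [bayesKernel, Kernel.withDensity_apply _ (measurable_inv_lintegral_mul hf), Kernel.const_apply,
    withDensity_apply _ .univ, Measure.restrict_univ, ← withDensity_smul _ (by fun_prop)]
  rfl

lemma isFiniteKernel_bayesKernel (hf : Measurable f) : IsFiniteKernel (bayesKernel ν f) :=
  ⟨1, ENNReal.one_lt_top, fun y ↦ by
    rw [bayesKernel_apply hf]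
    exact ENNReal.inv_mul_le_one _⟩

lemma withDensity_prod_eq_compProd_bayesKernel (hf : Measurable f)
    (hfin : ∀ᵐ y ∂μ, ∫⁻ x, f (y, x) ∂ν ≠ ∞) :
    (μ.prod ν).withDensity f =
      (μ.withDensity fun y ↦ ∫⁻ x, f (y, x) ∂ν) ⊗ₘ bayesKernel ν f := by
  have hZ : Measurable fun y ↦ ∫⁻ x, f (y, x) ∂ν := hf.lintegral_prod_right'
  have hd := measurable_inv_lintegral_mul (ν := ν) hf
  have := isFiniteKernel_bayesKernel (ν := ν) hf
  rw [bayesKernel] at this ⊢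
  rw [Measure.compProd_withDensity hd, Measure.compProd_const,
    prod_withDensity_left hZ, ← withDensity_mul _ (by fun_prop) hd]
  refine withDensity_congr_ae ((Measure.ae_prod_iff_ae_ae
    (measurableSet_eq_fun hf ((hZ.comp measurable_fst).mul hd))).2 ?_)
  filter_upwards [hfin] with y hy
  rcases eq_or_ne (∫⁻ x, f (y, x) ∂ν) 0 with h0 | h0
  · filter_upwards [(lintegral_eq_zero_iff (by fun_prop)).1 h0] with x hx
    simp_all
  · exact ae_of_all _ fun x ↦ (ENNReal.mul_inv_cancel_left h0 hy).symm

lemma condDistrib_ae_eq_bayesKernel [StandardBorelSpace E] [Nonempty E] {Ω : Type*}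
    [MeasurableSpace Ω] {Q : Measure Ω} [IsFiniteMeasure Q] {X : Ω → E} {Y : Ω → α}
    (hX : Measurable X) (hf : Measurable f)
    (h : Q.map (fun ω ↦ (Y ω, X ω)) = (μ.prod ν).withDensity f) :
    condDistrib X Y Q =ᵐ[Q.map Y] bayesKernel ν f := by
  have htotal : ∫⁻ y, ∫⁻ x, f (y, x) ∂ν ∂μ ≠ ∞ := by
    rw [← lintegral_prod _ hf.aemeasurable, ← setLIntegral_univ, ← withDensity_apply _ .univ, ← h]
    exact measure_ne_top _ _
  have hfin := (ae_lt_top hf.lintegral_prod_right' htotal).mono fun y ↦ LT.lt.ne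
  have := isFiniteKernel_bayesKernel (ν := ν) hf
  refine condDistrib_ae_eq_of_measure_eq_compProd Y hX.aemeasurable ?_
  rw [← Measure.fst_map_prodMk (X := Y) hX, h, fst_withDensity_prod hf,
    withDensity_prod_eq_compProd_bayesKernel hf hfin]

end Bayes

section Normalization

variable {E : Type*} [MeasurableSpace E] {ν : Measure E} {g : E → ℝ}

lemma measure_ne_zero_ne_top_of_isProbabilityMeasure_inv_smul {ρ : Measure E}
    (h : IsProbabilityMeasure ((ρ univ)⁻¹ • ρ)) : ρ univ ≠ 0 ∧ ρ univ ≠ ∞ := by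
  have h1 : (ρ univ)⁻¹ * ρ univ = 1 := h.measure_univ
  constructor <;> intro h0 <;> simp [h0] at h1

lemma withDensity_ofReal_univ (hg : Integrable g ν) (hg0 : 0 ≤ᵐ[ν] g) :
    ν.withDensity (fun x ↦ ENNReal.ofReal (g x)) univ = ENNReal.ofReal (∫ x, g x ∂ν) := by
  rw [withDensity_apply _ .univ, Measure.restrict_univ, ofReal_integral_eq_lintegral_ofReal hg hg0]

lemma integrable_of_withDensity_ofReal_univ_ne_top (hg : AEStronglyMeasurable g ν)
    (hg0 : 0 ≤ᵐ[ν] g) (h : ν.withDensity (fun x ↦ ENNReal.ofReal (g x)) univ ≠ ∞) :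
    Integrable g ν := by
  rw [withDensity_apply _ .univ, Measure.restrict_univ] at h
  exact (lintegral_ofReal_ne_top_iff_integrable hg hg0).1 h

lemma inv_smul_withDensity_ofReal (hg : Integrable g ν) (hg0 : 0 ≤ᵐ[ν] g)
    (hpos : 0 < ∫ x, g x ∂ν) :
    (ν.withDensity (fun x ↦ ENNReal.ofReal (g x)) univ)⁻¹ •
        ν.withDensity (fun x ↦ ENNReal.ofReal (g x)) =
      ν.withDensity fun x ↦ ENNReal.ofReal (g x / ∫ z, g z ∂ν) := by
  rw [withDensity_ofReal_univ hg hg0, ← withDensity_smul' _ _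
    (ENNReal.inv_ne_top.2 (ENNReal.ofReal_pos.2 hpos).ne')]
  congr with x
  rw [ENNReal.ofReal_div_of_pos hpos, Pi.smul_apply, smul_eq_mul, div_eq_mul_inv, mul_comm]

end Normalization

section IndependentNoise

variable {Ω E α δ ε : Type*} [MeasurableSpace Ω] [MeasurableSpace E] [MeasurableSpace α]
  [MeasurableSpace δ] [MeasurableSpace ε] [StandardBorelSpace E] [Nonempty E] {Q : Measure Ω}
  [IsProbabilityMeasure Q] {X : Ω → E} {Y : Ω → α} {R : Ω → δ} {F : Ω → ε}

lemma condDistrib_ae_eq_of_indepFun {g : α × δ → ε} {h : ε → α} (hX : Measurable X)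
    (hY : Measurable Y) (hR : Measurable R) (hF : Measurable F) (hg : Measurable g)
    (hh : Measurable h) (hind : IndepFun (fun ω ↦ (Y ω, X ω)) R Q)
    (hFg : ∀ᵐ ω ∂Q, F ω = g (Y ω, R ω)) (hYh : ∀ᵐ ω ∂Q, Y ω = h (F ω)) :
    condDistrib X F Q =ᵐ[Q.map F] fun z ↦ condDistrib X Y Q (h z) := by
  set κ := condDistrib X Y Q
  have hYR : Q.map (fun ω ↦ (Y ω, R ω)) = (Q.map Y).prod (Q.map R) :=
    (hind.comp measurable_fst measurable_id).map_prod_eq_prod_map_map hY.aemeasurable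
      hR.aemeasurable
  have hYXR := hind.map_prod_eq_prod_map_map (by fun_prop) hR.aemeasurable
  refine condDistrib_ae_eq_of_measure_eq_compProd F (κ := κ.comap h hh) hX.aemeasurable
    (Measure.ext_of_lintegral _ fun φ hφ ↦ ?_)
  have hinner : Measurable fun w : α × δ ↦ ∫⁻ x, φ (g w, x) ∂κ w.1 :=
    Measurable.lintegral_kernel_prod_right' (κ := κ.comap Prod.fst measurable_fst)
      (f := fun z ↦ φ (g z.1, z.2)) (by fun_prop)
  calc ∫⁻ z, φ z ∂Q.map (fun ω ↦ (F ω, X ω))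
      = ∫⁻ ω, φ (g (Y ω, R ω), X ω) ∂Q := by
        rw [lintegral_map hφ (by fun_prop)]
        exact lintegral_congr_ae (hFg.mono fun ω hω ↦ by simp only [hω])
    _ = ∫⁻ w, φ (g (w.1.1, w.2), w.1.2) ∂Q.map (fun ω ↦ ((Y ω, X ω), R ω)) := by
        rw [lintegral_map (by fun_prop) (by fun_prop)]
    _ = ∫⁻ r, ∫⁻ y, ∫⁻ x, φ (g (y, r), x) ∂κ y ∂Q.map Y ∂Q.map R := by
        rw [hYXR, lintegral_prod_symm _ (by fun_prop), ← compProd_map_condDistrib hX.aemeasurable]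
        exact lintegral_congr fun r ↦ Measure.lintegral_compProd (by fun_prop)
    _ = ∫⁻ w, ∫⁻ x, φ (g w, x) ∂κ w.1 ∂Q.map (fun ω ↦ (Y ω, R ω)) := by
        rw [hYR, lintegral_prod_symm _ hinner.aemeasurable]
    _ = ∫⁻ ω, ∫⁻ x, φ (F ω, x) ∂κ (h (F ω)) ∂Q := by
        rw [lintegral_map hinner (by fun_prop)]
        refine lintegral_congr_ae ?_
        filter_upwards [hFg, hYh] with ω hω hω'
        rw [← hω', hω]
    _ = ∫⁻ z, φ z ∂(Q.map F ⊗ₘ κ.comap h hh) := by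
        rw [Measure.lintegral_compProd hφ, lintegral_map (by fun_prop) hF]
        rfl

end IndependentNoise

lemma ae_integrable_id_condDistrib {Ω α : Type*} [MeasurableSpace Ω] [MeasurableSpace α]
    {Q : Measure Ω} [IsFiniteMeasure Q] {X : Ω → ℝ} {Y : Ω → α} (hX : Integrable X Q)
    (hY : AEMeasurable Y Q) :
    ∀ᵐ ω ∂Q, Integrable id (condDistrib X Y Q (Y ω)) :=
  Integrable.condDistrib_ae (f := Prod.snd) hY hX.aemeasurable <|
    (integrable_map_measure (by fun_prop) (hY.prodMk hX.aemeasurable)).2 hX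

lemma historySigma_eq_comap {Ω : Type u} {T : ℝ≥0} (ξ : Iic T → Ω → ℝ) (t : Iic T) :
    historySigma ξ t = MeasurableSpace.comap (fun ω (s : Iic t) ↦ ξ s ω) inferInstance := by
  simp_rw [historySigma, MeasurableSpace.pi, MeasurableSpace.comap_iSup,
    MeasurableSpace.comap_comp, iSup_subtype]
  rfl

section PosteriorDensity

variable {c b y : ℝ} {p : ℝ → ℝ}

lemma mul_scaledBetaLikelihood (x : ℝ) :
    p x * scaledBetaLikelihood c b y x =
      (Ioi y).indicator (fun x ↦ p x * x ^ (1 - c) * (x - y) ^ (b - 1)) x := by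
  simp only [scaledBetaLikelihood, mul_assoc, indicator_mul_right]

lemma integrable_mul_scaledBetaLikelihood_iff :
    Integrable (fun x ↦ p x * scaledBetaLikelihood c b y x) ↔
      IntegrableOn (fun x ↦ p x * x ^ (1 - c) * (x - y) ^ (b - 1)) (Ioi y) := by
  simp_rw [mul_scaledBetaLikelihood, integrable_indicator_iff measurableSet_Ioi]

lemma integral_mul_scaledBetaLikelihood :
    ∫ x, p x * scaledBetaLikelihood c b y x =
      ∫ x in Ioi y, p x * x ^ (1 - c) * (x - y) ^ (b - 1) := by
  simp_rw [mul_scaledBetaLikelihood, integral_indicator measurableSet_Ioi]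

lemma mul_scaledBetaLikelihood_mul_self (hy : 0 ≤ y) (x : ℝ) :
    p x * scaledBetaLikelihood c b y x * x =
      (Ioi y).indicator (fun x ↦ p x * x ^ (2 - c) * (x - y) ^ (b - 1)) x := by
  rw [mul_scaledBetaLikelihood]
  by_cases hx : x ∈ Ioi y
  · have hx0 : x ≠ 0 := (hy.trans_lt hx).ne'
    rw [indicator_of_mem hx, indicator_of_mem hx, show 2 - c = 1 - c + 1 by ring,
      Real.rpow_add_one hx0]
    ring
  · rw [indicator_of_notMem hx, indicator_of_notMem hx, zero_mul]

lemma mul_scaledBetaLikelihood_nonneg (hp0 : ∀ x, 0 < x → 0 ≤ p x) (hy : 0 ≤ y) (x : ℝ) :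
    0 ≤ p x * scaledBetaLikelihood c b y x := by
  rw [mul_scaledBetaLikelihood]
  refine indicator_nonneg (fun x hx ↦ ?_) x
  have hx0 : 0 < x := hy.trans_lt hx
  have hsub : 0 < x - y := sub_pos.2 hx
  have := hp0 x hx0
  positivity

lemma aemeasurable_mul_scaledBetaLikelihood (hp : AEMeasurable p (volume.restrict (Ioi 0)))
    (hy : 0 ≤ y) : AEMeasurable fun x ↦ p x * scaledBetaLikelihood c b y x := by
  simp_rw [mul_scaledBetaLikelihood]
  refine (aemeasurable_indicator_iff measurableSet_Ioi).2 ?_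
  have := hp.mono_measure (Measure.restrict_mono_set volume (Ioi_subset_Ioi hy))
  fun_prop

lemma withDensity_withDensity_scaledBetaLikelihood
    (hp : AEMeasurable p (volume.restrict (Ioi 0))) (hp0 : ∀ x, 0 < x → 0 ≤ p x) (hy : 0 ≤ y) :
    ((volume.restrict (Ioi 0)).withDensity fun x ↦ ENNReal.ofReal (p x)).withDensity
        (fun x ↦ ENNReal.ofReal (scaledBetaLikelihood c b y x)) =
      volume.withDensity fun x ↦ ENNReal.ofReal (p x * scaledBetaLikelihood c b y x) := by
  have hlik : Measurable (scaledBetaLikelihood c b y) :=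
    (measurable_scaledBetaLikelihood c b).of_uncurry_left
  rw [← withDensity_mul₀ (by fun_prop) (by fun_prop), ← withDensity_indicator measurableSet_Ioi]
  congr with x
  rcases le_or_gt x 0 with hx | hx
  · rw [indicator_of_notMem (notMem_Ioi.2 hx), scaledBetaLikelihood_of_le (hx.trans hy), mul_zero,
      ENNReal.ofReal_zero]
  · rw [indicator_of_mem (mem_Ioi.2 hx), Pi.mul_apply, ENNReal.ofReal_mul (hp0 x hx)]

lemma posteriorDensity_eq_div (m T t : ℝ) (x : ℝ) :
    posteriorDensity m T t p y x = p x * scaledBetaLikelihood (m * T) (m * (T - t)) y x /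
      ∫ z, p z * scaledBetaLikelihood (m * T) (m * (T - t)) y z := by
  rw [integral_mul_scaledBetaLikelihood, mul_scaledBetaLikelihood, posteriorDensity]
  by_cases hx : x ∈ Ioi y <;> simp [hx]

lemma aemeasurable_posteriorDensity (hp : AEMeasurable p (volume.restrict (Ioi 0))) (hy : 0 ≤ y)
    (m T t : ℝ) : AEMeasurable (posteriorDensity m T t p y) := by
  simp_rw [funext (posteriorDensity_eq_div (p := p) (y := y) m T t)]
  exact (aemeasurable_mul_scaledBetaLikelihood hp hy).div_const _

lemma posteriorDensity_nonneg (hp0 : ∀ x, 0 < x → 0 ≤ p x) (hy : 0 ≤ y) (m T t x : ℝ) :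
    0 ≤ posteriorDensity m T t p y x := by
  rw [posteriorDensity_eq_div]
  exact div_nonneg (mul_scaledBetaLikelihood_nonneg hp0 hy x)
    (integral_nonneg fun z ↦ mul_scaledBetaLikelihood_nonneg hp0 hy z)

lemma integral_withDensity_posteriorDensity (hp : AEMeasurable p (volume.restrict (Ioi 0)))
    (hp0 : ∀ x, 0 < x → 0 ≤ p x) (hy : 0 ≤ y) (m T t : ℝ) (f : ℝ → ℝ) :
    ∫ x, f x ∂volume.withDensity (fun x ↦ ENNReal.ofReal (posteriorDensity m T t p y x)) =
      ∫ x, posteriorDensity m T t p y x * f x := by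
  rw [integral_withDensity_eq_integral_toReal_smul₀
    (aemeasurable_posteriorDensity hp hy m T t).ennreal_ofReal
    (ae_of_all _ fun _ ↦ ENNReal.ofReal_lt_top)]
  simp_rw [ENNReal.toReal_ofReal (posteriorDensity_nonneg hp0 hy m T t _), smul_eq_mul]

lemma integral_posteriorDensity_mul_self (hy : 0 ≤ y) (m T t : ℝ) :
    ∫ x, posteriorDensity m T t p y x * x =
      (∫ x in Ioi y, p x * x ^ (2 - m * T) * (x - y) ^ (m * (T - t) - 1)) /
        ∫ x in Ioi y, p x * x ^ (1 - m * T) * (x - y) ^ (m * (T - t) - 1) := by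
  simp_rw [posteriorDensity_eq_div, div_mul_eq_mul_div, mul_scaledBetaLikelihood_mul_self hy,
    integral_div, integral_indicator measurableSet_Ioi, integral_mul_scaledBetaLikelihood]

lemma integrable_id_withDensity_posteriorDensity_iff
    (hp : AEMeasurable p (volume.restrict (Ioi 0))) (hp0 : ∀ x, 0 < x → 0 ≤ p x) (hy : 0 ≤ y)
    {m T t : ℝ}
    (hpos : 0 < ∫ x in Ioi y, p x * x ^ (1 - m * T) * (x - y) ^ (m * (T - t) - 1)) :
    Integrable id
        (volume.withDensity fun x ↦ ENNReal.ofReal (posteriorDensity m T t p y x)) ↔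
      IntegrableOn (fun x ↦ p x * x ^ (2 - m * T) * (x - y) ^ (m * (T - t) - 1)) (Ioi y) := by
  rw [integrable_withDensity_iff_integrable_smul₀'
    (aemeasurable_posteriorDensity hp hy m T t).ennreal_ofReal
    (ae_of_all _ fun _ ↦ ENNReal.ofReal_lt_top)]
  simp_rw [ENNReal.toReal_ofReal (posteriorDensity_nonneg hp0 hy m T t _), smul_eq_mul, id_eq,
    posteriorDensity_eq_div, div_mul_eq_mul_div, mul_scaledBetaLikelihood_mul_self hy,
    integral_mul_scaledBetaLikelihood, div_eq_mul_inv]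
  rw [integrable_mul_const_iff (inv_ne_zero hpos.ne').isUnit,
    integrable_indicator_iff measurableSet_Ioi]

lemma bayesKernel_scaledBetaLikelihood_eq (hp : AEMeasurable p (volume.restrict (Ioi 0)))
    (hp0 : ∀ x, 0 < x → 0 ≤ p x) (hy : 0 ≤ y)
    {m T t : ℝ} (hint : Integrable fun x ↦ p x * scaledBetaLikelihood (m * T) (m * (T - t)) y x)
    (hpos : 0 < ∫ x, p x * scaledBetaLikelihood (m * T) (m * (T - t)) y x) :
    bayesKernel ((volume.restrict (Ioi 0)).withDensity fun x ↦ ENNReal.ofReal (p x))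
      (fun z ↦ ENNReal.ofReal (scaledBetaLikelihood (m * T) (m * (T - t)) z.1 z.2)) y =
      volume.withDensity fun x ↦ ENNReal.ofReal (posteriorDensity m T t p y x) := by
  simp_rw [bayesKernel_apply (measurable_scaledBetaLikelihood _ _).ennreal_ofReal,
    withDensity_withDensity_scaledBetaLikelihood hp hp0 hy, posteriorDensity_eq_div]
  exact inv_smul_withDensity_ofReal hint
    (ae_of_all _ (mul_scaledBetaLikelihood_nonneg hp0 hy)) hpos

lemma integrable_and_integral_pos_of_isProbabilityMeasure_bayesKernel
    (hp : AEMeasurable p (volume.restrict (Ioi 0))) (hp0 : ∀ x, 0 < x → 0 ≤ p x) (hy : 0 ≤ y)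
    (h : IsProbabilityMeasure
      (bayesKernel ((volume.restrict (Ioi 0)).withDensity fun x ↦ ENNReal.ofReal (p x))
        (fun z ↦ ENNReal.ofReal (scaledBetaLikelihood c b z.1 z.2)) y)) :
    Integrable (fun x ↦ p x * scaledBetaLikelihood c b y x) ∧
      0 < ∫ x, p x * scaledBetaLikelihood c b y x := by
  have hnn : 0 ≤ᵐ[volume] fun x ↦ p x * scaledBetaLikelihood c b y x :=
    ae_of_all _ (mul_scaledBetaLikelihood_nonneg hp0 hy)
  rw [bayesKernel_apply (measurable_scaledBetaLikelihood c b).ennreal_ofReal] at h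
  obtain ⟨hne, htop⟩ := measure_ne_zero_ne_top_of_isProbabilityMeasure_inv_smul h
  simp only [withDensity_withDensity_scaledBetaLikelihood hp hp0 hy] at hne htop
  have hint := integrable_of_withDensity_ofReal_univ_ne_top
    (aemeasurable_mul_scaledBetaLikelihood hp hy).aestronglyMeasurable hnn htop
  rw [withDensity_ofReal_univ hint hnn] at hne
  exact ⟨hint, ENNReal.ofReal_pos.1 (pos_iff_ne_zero.2 hne)⟩

end PosteriorDensity

lemma measurable_claimsProcess {Ω : Type u} [MeasurableSpace Ω] {T : ℝ≥0} {X : Ω → ℝ}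
    {β : Iic T → Ω → ℝ} {t : Iic T} (hX : Measurable X) (hβ : Measurable (β t)) :
    Measurable (claimsProcess X β t) :=
  hX.mul hβ

namespace IsStandardGammaBridge

variable {Ω : Type u} [MeasurableSpace Ω] {Q : Measure Ω} [IsProbabilityMeasure Q] {m : ℝ}
  {T : ℝ≥0} {β : Iic T → Ω → ℝ} {X : Ω → ℝ} {t : Iic T}

lemma indepFun_claimsProcess_prodMk (hβ : IsStandardGammaBridge m T β Q) (hm : 0 < m) (hT : 0 < T)
    (hX : Measurable X) (hind : IndepFun X (fun ω t ↦ β t ω) Q) (t : Iic T) :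
    IndepFun (fun ω ↦ (claimsProcess X β t ω, X ω)) (fun ω (s : Iic t) ↦ β s ω / β t ω) Q := by
  have hmeas := hβ.measurable
  have hX_bridge : IndepFun X (fun ω ↦ (β t ω, fun s : Iic t ↦ β s ω / β t ω)) Q :=
    hind.comp (ψ := fun x : Iic T → ℝ ↦ (x t, fun s : Iic t ↦ x s / x t)) measurable_id
      (by fun_prop)
  have hpair := indepFun_prodMk_left_of_indepFun_prodMk_right hX (hmeas t) (by fun_prop) hX_bridge
    (hβ.indepFun_div_process hm hT t).symm
  exact hpair.comp (φ := fun z : ℝ × ℝ ↦ (z.1 * z.2, z.1)) (by fun_prop) measurable_id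

lemma condDistrib_history_ae_eq (hβ : IsStandardGammaBridge m T β Q) (hm : 0 < m)
    (htT : (t : ℝ≥0) < T) (hX : Measurable X) (hind : IndepFun X (fun ω t ↦ β t ω) Q) :
    condDistrib X (fun ω (s : Iic t) ↦ claimsProcess X β s ω) Q
      =ᵐ[Q.map fun ω (s : Iic t) ↦ claimsProcess X β s ω]
        fun x ↦ condDistrib X (claimsProcess X β t) Q (x ⟨t, self_mem_Iic⟩) := by
  have hmeas := hβ.measurable
  refine condDistrib_ae_eq_of_indepFun (g := fun (z : ℝ × (Iic t → ℝ)) s ↦ z.1 * z.2 s) hX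
    (measurable_claimsProcess hX (hmeas t)) (by fun_prop)
    (measurable_pi_lambda _ fun s ↦ measurable_claimsProcess hX (hmeas s)) (by fun_prop)
    (measurable_pi_apply _)
    (hβ.indepFun_claimsProcess_prodMk hm (bot_le.trans_lt htT) hX hind t) ?_
    (ae_of_all _ fun _ ↦ rfl)
  filter_upwards [hβ.ae_mul_div_eq hm htT] with ω hω
  funext s
  rw [claimsProcess, claimsProcess, mul_assoc, hω s]

lemma condExp_historySigma_ae_eq {f : ℝ → ℝ} (hβ : IsStandardGammaBridge m T β Q) (hm : 0 < m)
    (htT : (t : ℝ≥0) < T) (hX : Measurable X) (hind : IndepFun X (fun ω t ↦ β t ω) Q)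
    (hf : StronglyMeasurable f) (hfX : Integrable (fun ω ↦ f (X ω)) Q) :
    Q[fun ω ↦ f (X ω) | historySigma (claimsProcess X β) t] =ᵐ[Q]
      fun ω ↦ ∫ x, f x ∂condDistrib X (claimsProcess X β t) Q (claimsProcess X β t ω) := by
  have hhist : Measurable fun ω (s : Iic t) ↦ claimsProcess X β s ω :=
    measurable_pi_lambda _ fun s ↦ measurable_claimsProcess hX (hβ.measurable s)
  rw [historySigma_eq_comap]
  filter_upwards [condExp_ae_eq_integral_condDistrib hhist hX.aemeasurable hf hfX,
    ae_of_ae_map hhist.aemeasurable (hβ.condDistrib_history_ae_eq hm htT hX hind)] with ω h1 h2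
  rw [h1, h2]

variable {ν : Measure ℝ} [SFinite ν]

lemma exists_map_claimsProcess_prodMk (hβ : IsStandardGammaBridge m T β Q) (hm : 0 < m)
    (htT : (t : ℝ≥0) < T) (hX : HasLaw X ν Q) (hν : ∀ᵐ x ∂ν, 0 < x)
    (hind : IndepFun X (fun ω t ↦ β t ω) Q) :
    ∃ μ : Measure ℝ, SFinite μ ∧ Q.map (fun ω ↦ (claimsProcess X β t ω, X ω)) =
      (μ.prod ν).withDensity
        fun z ↦ ENNReal.ofReal (scaledBetaLikelihood (m * T) (m * (T - t)) z.1 z.2) := by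
  have hmeas := (hβ.measurable t).aemeasurable (μ := Q)
  have hprod : Q.map (fun ω ↦ (β t ω, X ω)) = (Q.map (β t)).prod ν := by
    rw [← hX.map_eq]
    exact (hind.comp measurable_id (measurable_pi_apply t)).symm.map_prod_eq_prod_map_map
      hmeas hX.aemeasurable
  have hmap : Q.map (fun ω ↦ (claimsProcess X β t ω, X ω)) =
      ((Q.map (β t)).prod ν).map fun z ↦ (z.2 * z.1, z.2) := by
    rw [← hprod, AEMeasurable.map_map_of_aemeasurable (by fun_prop) (hmeas.prodMk hX.aemeasurable)]
    rfl
  rcases eq_zero_or_pos (t : ℝ≥0) with ht0 | ht0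
  · refine ⟨Measure.dirac 0, inferInstance, ?_⟩
    rw [hmap, hβ.map_eq_dirac ht0, map_mul_prodMk_dirac_prod (m * T) hν, ht0, NNReal.coe_zero,
      sub_zero]
  · rw [hmap, hβ.map_eq_betaMeasure hm ht0 htT, map_mul_prodMk_betaMeasure_prod _ _ hν,
      show m * t + m * (T - t) = m * T by ring]
    exact ⟨_, inferInstance, rfl⟩

lemma condDistrib_claimsProcess_ae_eq (hβ : IsStandardGammaBridge m T β Q) (hm : 0 < m)
    (htT : (t : ℝ≥0) < T) (hXm : Measurable X) (hX : HasLaw X ν Q) (hν : ∀ᵐ x ∂ν, 0 < x)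
    (hind : IndepFun X (fun ω t ↦ β t ω) Q) :
    ∀ᵐ ω ∂Q, condDistrib X (claimsProcess X β t) Q (claimsProcess X β t ω) =
      bayesKernel ν (fun z ↦ ENNReal.ofReal (scaledBetaLikelihood (m * T) (m * (T - t)) z.1 z.2))
        (claimsProcess X β t ω) := by
  obtain ⟨μ, _, hμ⟩ := hβ.exists_map_claimsProcess_prodMk hm htT hX hν hind
  exact ae_of_ae_map (measurable_claimsProcess hXm (hβ.measurable t)).aemeasurable
    (condDistrib_ae_eq_bayesKernel hXm (measurable_scaledBetaLikelihood _ _).ennreal_ofReal hμ)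

lemma ae_condDistrib_claimsProcess_eq_posteriorDensity {p : ℝ → ℝ}
    (hβ : IsStandardGammaBridge m T β Q) (hm : 0 < m) (htT : (t : ℝ≥0) < T) (hX : Measurable X)
    (hp : AEMeasurable p (volume.restrict (Ioi 0))) (hp0 : ∀ x, 0 < x → 0 ≤ p x)
    (hXp : HasLaw X ((volume.restrict (Ioi 0)).withDensity (fun x ↦ ENNReal.ofReal (p x))) Q)
    (hind : IndepFun X (fun ω t ↦ β t ω) Q) :
    ∀ᵐ ω ∂Q, 0 ≤ claimsProcess X β t ω ∧
      IntegrableOn (fun x ↦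
        p x * x ^ (1 - m * T) * (x - claimsProcess X β t ω) ^ (m * (T - t) - 1))
        (Ioi (claimsProcess X β t ω)) ∧
      0 < (∫ x in Ioi (claimsProcess X β t ω),
        p x * x ^ (1 - m * T) * (x - claimsProcess X β t ω) ^ (m * (T - t) - 1)) ∧
      condDistrib X (claimsProcess X β t) Q (claimsProcess X β t ω) = volume.withDensity
        fun x ↦ ENNReal.ofReal (posteriorDensity m T t p (claimsProcess X β t ω) x) := by
  have hpos : ∀ᵐ x ∂(volume.restrict (Ioi 0)).withDensity (fun x ↦ ENNReal.ofReal (p x)), 0 < x :=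
    (withDensity_absolutelyContinuous _ _).ae_le (ae_restrict_mem measurableSet_Ioi)
  filter_upwards [hβ.condDistrib_claimsProcess_ae_eq hm htT hX hXp hpos hind,
    hβ.ae_nonneg hm htT, ae_of_ae_map hX.aemeasurable (hXp.map_eq ▸ hpos)] with ω hlaw hβ0 hX0
  have hξ0 : 0 ≤ claimsProcess X β t ω := mul_nonneg hX0.le hβ0
  have hprob : IsProbabilityMeasure
      (condDistrib X (claimsProcess X β t) Q (claimsProcess X β t ω)) := inferInstance
  rw [hlaw] at hprob
  obtain ⟨hint, hint0⟩ :=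
    integrable_and_integral_pos_of_isProbabilityMeasure_bayesKernel hp hp0 hξ0 hprob
  rw [bayesKernel_scaledBetaLikelihood_eq hp hp0 hξ0 hint hint0] at hlaw
  rw [integrable_mul_scaledBetaLikelihood_iff] at hint
  rw [integral_mul_scaledBetaLikelihood] at hint0
  exact ⟨hξ0, hint, hint0, hlaw⟩

end IsStandardGammaBridge

theorem proposition5 {Ω : Type u} [MeasurableSpace Ω] (Q : Measure Ω) [IsProbabilityMeasure Q]
    (m : ℝ) (hm : 0 < m) (T : ℝ≥0) (hT : 0 < T) (P : ℝ≥0 → ℝ≥0 → ℝ)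
    (X : Ω → ℝ) (hX : Measurable X) (hXint : Integrable X Q)
    (p : ℝ → ℝ) (hp : AEMeasurable p (volume.restrict (Ioi 0))) (hp0 : ∀ x, 0 < x → 0 ≤ p x)
    (hXp : HasLaw X ((volume.restrict (Ioi 0)).withDensity (fun x ↦ ENNReal.ofReal (p x))) Q)
    (β : Iic T → Ω → ℝ) (hβ : IsStandardGammaBridge m T β Q)
    (hind : IndepFun X (fun ω t ↦ β t ω) Q)
    (ξ : Iic T → Ω → ℝ) (hξ : ξ = claimsProcess X β)
    (t : Iic T) (ht : (t : ℝ≥0) < T) :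
    -- almost surely, both integrals converge and the denominator is positive
    (∀ᵐ ω ∂Q,
      IntegrableOn (fun x ↦ p x * x ^ (2 - m * T) * (x - ξ t ω) ^ (m * (T - t) - 1))
        (Ioi (ξ t ω)) ∧
      IntegrableOn (fun x ↦ p x * x ^ (1 - m * T) * (x - ξ t ω) ^ (m * (T - t) - 1))
        (Ioi (ξ t ω)) ∧
      0 < ∫ x in Ioi (ξ t ω), p x * x ^ (1 - m * T) * (x - ξ t ω) ^ (m * (T - t) - 1)) ∧
    -- the value process
    (∀ᵐ ω ∂Q, valueProcess Q P X ξ t ω =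
      P t T *
        ((∫ x in Ioi (ξ t ω), p x * x ^ (2 - m * T) * (x - ξ t ω) ^ (m * (T - t) - 1)) /
          ∫ x in Ioi (ξ t ω), p x * x ^ (1 - m * T) * (x - ξ t ω) ^ (m * (T - t) - 1))) ∧
    -- `π_t` is the density of the conditional law of `X` given `ξ_t`
    (∀ᵐ ω ∂Q, condDistrib X (ξ t) Q (ξ t ω) =
      volume.withDensity (fun x ↦ ENNReal.ofReal (posteriorDensity m T t p (ξ t ω) x))) ∧
    -- `π_t` is also the density of the conditional law of `X` given the history up to time `t`
    (∀ B : Set ℝ, MeasurableSet B → ∀ᵐ ω ∂Q, (Q⟦X ⁻¹' B | historySigma ξ t⟧) ω =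
      ∫ x in B, posteriorDensity m T t p (ξ t ω) x) := by
  subst hξ
  have hpost := hβ.ae_condDistrib_claimsProcess_eq_posteriorDensity hm ht hX hp hp0 hXp hind
  have hmean := ae_integrable_id_condDistrib hXint
    (measurable_claimsProcess hX (hβ.measurable t)).aemeasurable
  refine ⟨?_, ?_, hpost.mono fun ω h ↦ h.2.2.2, fun B hB ↦ ?_⟩
  · filter_upwards [hpost, hmean] with ω ⟨hξ0, hden, hpos, hlaw⟩ hid
    rw [hlaw, integrable_id_withDensity_posteriorDensity_iff hp hp0 hξ0 hpos] at hid
    exact ⟨hid, hden, hpos⟩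
  · filter_upwards [hpost, hβ.condExp_historySigma_ae_eq hm ht hX hind stronglyMeasurable_id hXint]
      with ω ⟨hξ0, _, _, hlaw⟩ hE
    rw [hlaw, integral_withDensity_posteriorDensity hp hp0 hξ0] at hE
    exact congrArg (P t T * ·) (hE.trans (integral_posteriorDensity_mul_self hξ0 m T t))
  · filter_upwards [hpost, hβ.condExp_historySigma_ae_eq hm ht hX hind
      (f := B.indicator fun _ ↦ 1) (stronglyMeasurable_const.indicator hB)
      ((integrable_const 1).indicator (hX hB))] with ω ⟨hξ0, _, _, hlaw⟩ hE
    rw [hlaw, integral_withDensity_posteriorDensity hp hp0 hξ0] at hE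
    refine hE.trans ?_
    simp_rw [← integral_indicator hB, ← indicator_mul_right, mul_one]
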